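/- Let $f:\mathbb{R}^n\to\mathbb{R}$ and $g:\mathbb{R}^n\to\mathbb{R}^m$ be twice continuously differentiable, let $K\subseteq\mathbb{R}^m$ be closed, $C:=g^{-1}(K)$ and $L(x,\lambda):=f(x)+\langle\lambda,g(x)\rangle$. Notation. For a set $S\subseteq\mathbb{R}^p$ (sequences $t_k,r_k\downarrow 0$ below consist of positive numbers): - $T_S(x):=\{d:\exists t_k\downarrow0,\ d_k\to d,\ x+t_kd_k\in S\}$; - $T^2_S(x;d):=\{w:\exists t_k\downarrow0,\ w_k\to w,\ x+t_kd+\tfrac12t_k^2w_k\in S\}$; - $T''_S(x;d):=\{w:\exists (t_k,r_k)\downarrow(0,0),\ w_k\to w,\ t_k/r_k\to0,\ x+t_kd+\tfrac12t_kr_kw_k\in S\}$; - $\hat N_S(x):=\{v:\limsup_{y\to x,\,y\in S\setminus\{x\}}\langle v,y-x\rangle/\|y-x\|\le0\}$ if $x\in S$ and $\hat N_S(x):=\emptyset$ otherwise; $N_S(x):=\limsup_{y\to x,\,y\in S}\hat N_S(y)$ if $x\in S$ and $N_S(x):=\emptyset$ otherwise; $N_S(x;d):=\limsup_{t\downarrow0,\,d'\to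 d}\hat N_S(x+td')$ (outer set limits); - $\sigma_S(\lambda):=\sup_{u\in S}\langle\lambda,u\rangle\in[-\infty,+\infty]$, with $\sigma_\emptyset=-\infty$; - $V_{\rho,\delta}(d):=\{w:\|w\|\le\delta,\ \big\|\,\|d\|w-\|w\|d\,\big\|\le\rho\|w\|\|d\|\}$. Let $\bar x\in C$ and let $d\in T_C(\bar x)$ with $\nabla f(\bar x)d=0$. Assume that $\bar x$ is a local optimal solution of $\min f(x)$ s.t. $g(x)\in K$ in direction $d$, that is, there are $\rho,\delta>0$ with $f(x)\ge f(\bar x)$ for all $x\in C\cap(\bar x+V_{\rho,\delta}(d))$. Assume also that the metric subregularity constraint qualification holds at $\bar x$ in direction $d$, that is, there are $\rho,\delta,\kappa>0$ with $\mathrm{dist}(x,C)\le\kappa\,\mathrm{dist}(g(x),K)$ for all $x\in\bar x+V_{\rho,\delta}(d)$. Put $$\Lambda(\bar x;d):=\{\lambda\in\mathbb{R}^m:\lambda\in N_K(g(\bar x);\nabla g(\bar x)d),\ \nabla_xL(\bar x,\lambda)=0\},$$ $$\Theta:=\nabla g(\bar x)\big(T''_C(\bar x;d)\big),\qquad \Omega:=\nabla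 g(\bar x)\big(T^2_C(\bar x;d)\big)+\nabla^2g(\bar x)(d,d),$$ $$\alpha:=\inf_{w\in T^2_C(\bar x;d)}\big(\nabla f(\bar x)w+\nabla^2f(\bar x)(d,d)\big).$$ Then: (i) There exists $\lambda\in\Lambda(\bar x;d)$ such that $\sigma_\Theta(\lambda)\le0$ and $\lambda\in N_{T''_K(g(\bar x);\nabla g(\bar x)d)}(0)$. (ii) If $T^2_K(g(\bar x);\nabla g(\bar x)d)\neq\emptyset$, then there exists $\lambda\in\Lambda(\bar x;d)$ such that $$\nabla^2_{xx}L(\bar x,\lambda)(d,d)-\sigma_\Omega(\lambda)\ge0,$$ and, for this same $\lambda$, there exist sequences $w_k\in T^2_C(\bar x;d)$ and $\lambda_k\in N_{T^2_K(g(\bar x);\nabla g(\bar x)d)}\big(\nabla g(\bar x)w_k+\nabla^2g(\bar x)(d,d)\big)$ such that $\nabla f(\bar x)w_k+\nabla^2f(\bar x)(d,d)\to\alpha$, $\langle\nabla g(\bar x)^T\lambda_k+\nabla f(\bar x),w_k\rangle\to0$ and $\lambda_k\to\lambda$. -/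

import Mathlib

open Filter Topology

namespace DirOpt

section Cones

variable {E : Type*} [NormedAddCommGroup E] [InnerProductSpace ℝ E]

/-- The Bouligand (contingent) tangent cone `T_S(x)`: all `d` for which there are `t_k ↓ 0` and
`d_k → d` with `x + t_k d_k ∈ S`. -/
def tangentCone (S : Set E) (x : E) : Set E :=
  {d | ∃ (t : ℕ → ℝ) (u : ℕ → E), (∀ k, 0 < t k) ∧ Tendsto t atTop (𝓝 0) ∧
    Tendsto u atTop (𝓝 d) ∧ ∀ k, x + t k • u k ∈ S}

/-- The outer second-order tangent set `T²_S(x; d)`. -/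
def secondTangentSet (S : Set E) (x d : E) : Set E :=
  {w | ∃ (t : ℕ → ℝ) (u : ℕ → E), (∀ k, 0 < t k) ∧ Tendsto t atTop (𝓝 0) ∧
    Tendsto u atTop (𝓝 w) ∧ ∀ k, x + t k • d + ((1 / 2 : ℝ) * t k ^ 2) • u k ∈ S}

/-- The asymptotic second-order tangent cone `T''_S(x; d)`. -/
def asympSecondTangentCone (S : Set E) (x d : E) : Set E :=
  {w | ∃ (t r : ℕ → ℝ) (u : ℕ → E), (∀ k, 0 < t k) ∧ (∀ k, 0 < r k) ∧
    Tendsto t atTop (𝓝 0) ∧ Tendsto r atTop (𝓝 0) ∧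
    Tendsto (fun k => t k / r k) atTop (𝓝 0) ∧ Tendsto u atTop (𝓝 w) ∧
    ∀ k, x + t k • d + ((1 / 2 : ℝ) * t k * r k) • u k ∈ S}

/-- The Fréchet normal cone `N̂_S(x)`, empty when `x ∉ S`. The condition says that the upper limit
of `⟪v, y - x⟫ / ‖y - x‖`, as `y → x` within `S`, is at most `0`. -/
def frechetNormalCone (S : Set E) (x : E) : Set E :=
  {v | x ∈ S ∧ ∀ ε : ℝ, 0 < ε → ∀ᶠ y in 𝓝[S] x, inner ℝ v (y - x) ≤ ε * ‖y - x‖}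

/-- The limiting (Mordukhovich) normal cone `N_S(x)`, empty when `x ∉ S`. -/
def limitingNormalCone (S : Set E) (x : E) : Set E :=
  {v | x ∈ S ∧ ∃ y u : ℕ → E, (∀ k, y k ∈ S) ∧ Tendsto y atTop (𝓝 x) ∧
    Tendsto u atTop (𝓝 v) ∧ ∀ k, u k ∈ frechetNormalCone S (y k)}

/-- The limiting normal cone `N_S(x; d)` to `S` at `x` in direction `d`: the upper limit of
`N̂_S(x + t d')` as `t ↓ 0`, `d' → d`. -/
def dirLimitingNormalCone (S : Set E) (x d : E) : Set E :=
  {v | ∃ (t : ℕ → ℝ) (e u : ℕ → E), (∀ k, 0 < t k) ∧ Tendsto t atTop (𝓝 0) ∧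
    Tendsto e atTop (𝓝 d) ∧ Tendsto u atTop (𝓝 v) ∧
    ∀ k, u k ∈ frechetNormalCone S (x + t k • e k)}

/-- The support function `σ_S(v) = sup_{u ∈ S} ⟪v, u⟫`, extended-real valued, with `σ_∅ = -∞`. -/
noncomputable def supportFun (S : Set E) (v : E) : EReal :=
  ⨆ u ∈ S, ((inner ℝ v u : ℝ) : EReal)

/-- The directional neighbourhood `V_{ρ,δ}(d)` of the direction `d`. -/
def dirNhd (ρ δ : ℝ) (d : E) : Set E :=
  {w | ‖w‖ ≤ δ ∧ ‖‖d‖ • w - ‖w‖ • d‖ ≤ ρ * ‖w‖ * ‖d‖}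

/-- `x` is a local optimal solution, in direction `d`, of minimizing `f` over `C`. -/
def IsDirLocalMin (f : E → ℝ) (C : Set E) (x d : E) : Prop :=
  x ∈ C ∧ ∃ ρ δ : ℝ, 0 < ρ ∧ 0 < δ ∧ ∀ w ∈ dirNhd ρ δ d, x + w ∈ C → f x ≤ f (x + w)

end Cones

section Problem

variable {E : Type*} [NormedAddCommGroup E] [InnerProductSpace ℝ E]
variable {F : Type*} [NormedAddCommGroup F] [InnerProductSpace ℝ F]

/-- The set-valued map `M` is metrically subregular at `(x, y)` in direction `d`; the distance to
the empty set is `∞`. -/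
def DirMetricSubregular (M : E → Set F) (x : E) (y : F) (d : E) : Prop :=
  ∃ ρ δ κ : ℝ, 0 < ρ ∧ 0 < δ ∧ 0 < κ ∧ ∀ w ∈ dirNhd ρ δ d,
    Metric.infEDist (x + w) {u | y ∈ M u} ≤
      ENNReal.ofReal κ * Metric.infEDist y (M (x + w))

/-- The metric subregularity constraint qualification for the system `g(x) ∈ K` at `x` in
direction `d`: directional metric subregularity of `u ↦ g(u) - K` at `(x, 0)`. -/
def DirMSCQ (g : E → F) (K : Set F) (x d : E) : Prop :=
  DirMetricSubregular (fun u => {y | ∃ z ∈ K, y = g u - z}) x 0 d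

/-- The second derivative `∇²h(x)(d, d)`. -/
noncomputable def secondDeriv (h : E → F) (x d : E) : F :=
  fderiv ℝ (fderiv ℝ h) x d d

/-- The Lagrangian `L(x, v) = f(x) + ⟪v, g(x)⟫`. -/
noncomputable def lagrangian (f : E → ℝ) (g : E → F) (x : E) (v : F) : ℝ :=
  f x + inner ℝ v (g x)

/-- The set `Λ(x; d)` of M-multipliers in direction `d`. -/
def multipliers (f : E → ℝ) (g : E → F) (K : Set F) (x d : E) : Set F :=
  {v | v ∈ dirLimitingNormalCone K (g x) (fderiv ℝ g x d) ∧
    fderiv ℝ (fun u => lagrangian f g u v) x = 0}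

/-- `Θ = ∇g(x)(T''_C(x; d))` with `C = g⁻¹(K)`. -/
def thetaSet (g : E → F) (K : Set F) (x d : E) : Set F :=
  (fun w => fderiv ℝ g x w) '' asympSecondTangentCone (g ⁻¹' K) x d

/-- `Ω = ∇g(x)(T²_C(x; d)) + ∇²g(x)(d, d)` with `C = g⁻¹(K)`. -/
def omegaSet (g : E → F) (K : Set F) (x d : E) : Set F :=
  (fun w => fderiv ℝ g x w + secondDeriv g x d) '' secondTangentSet (g ⁻¹' K) x d

/-- `α = inf_{w ∈ T²_C(x; d)} (∇f(x) w + ∇²f(x)(d, d))`, an extended real number. -/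
noncomputable def alphaVal (f : E → ℝ) (C : Set E) (x d : E) : EReal :=
  ⨅ w ∈ secondTangentSet C x d, ((fderiv ℝ f x w + secondDeriv f x d : ℝ) : EReal)

end Problem

end DirOpt

/-!
Both parts are multiplier rules for the problem obtained by linearizing `min f` subject to
`g ∈ K` along parabolic curves `x + t d + ½ t r w`. With `r = t` the tangent sets involved are
`T²`, with `t / r → 0` they are `T''`; `parabolicTangentSet` treats both at once, along a filter of
step sizes `(t, r)` with `t / r → τ`, where `τ = 1` or `τ = 0`.

Local minimality in direction `d` and a second-order expansion give
`∇f(x) w + τ ∇²f(x)(d, d) ≥ 0` for all tangents `w` to `C = g⁻¹(K)`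
(`IsDirLocalMin.nonneg_of_mem`). Directional metric subregularity, applied along the curves, passes
in the limit to a global error bound for the linearized system
`∇g(x) w + τ ∇²g(x)(d, d) ∈ T_K` (`DirMSCQ.exists_tangent_near`). The error bound turns quadratic
penalization into an exact device: the penalty multipliers stay bounded by a fixed multiple of the
gradient of the objective and converge to a limiting normal of the tangent set of `K`
(`exists_multiplier`). Finally, limiting normals to a tangent set of `K` are limiting normals to `K`
in direction `∇g(x) d`, because nearest points in the blow-ups of `K` converge to nearest points in
the tangent set (`limitingNormalCone_parabolicTangentSet_subset`).

For `T''` the point `w = 0` is optimal, and one application of the multiplier rule suffices. For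
`T²` the infimum `α` need not be attained, so the objective is regularized by `ε/2 ‖w‖²`; the
minimizers `w_ε` satisfy `ε ‖w_ε‖² → 0`, whence the multipliers at `w_ε` are bounded, their
stationarity residual is `-ε w_ε → 0`, and its inner product with `w_ε` vanishes in the limit. The
inequalities for the support functions need no separate argument: if `∇ₓL(x, v) = 0`, then
`⟪v, ∇g(x) w⟫ = -∇f(x) w`, and they restate the nonnegativity on the tangent sets.
-/

namespace DirOpt

/-! ### Tangent sets as upper limits along a filter of step sizes -/

section ParabolicTangent

variable {E : Type*} [NormedAddCommGroup E] [InnerProductSpace ℝ E]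

/-- The set of all `w` approached by points `w'` with `x + t d + ½ t r w' ∈ S`, where the pair
of step sizes `(t, r)` runs along the filter `L`. Suitable filters give both `T²_S(x; d)` and
`T''_S(x; d)`. -/
def parabolicTangentSet (L : Filter (ℝ × ℝ)) (S : Set E) (x d : E) : Set E :=
  {w | ∃ᶠ q in L ×ˢ 𝓝 w, x + q.1.1 • d + ((1 / 2 : ℝ) * q.1.1 * q.1.2) • q.2 ∈ S}

/-- The step sizes `(t, t)` with `t ↓ 0`. -/
def diagonalSteps : Filter (ℝ × ℝ) := map (fun t => (t, t)) (𝓝[>] 0)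

/-- The step sizes `(t, r)` with `t ↓ 0`, `r ↓ 0` and `t / r → 0`. -/
noncomputable def asympSteps : Filter (ℝ × ℝ) :=
  (𝓝[>] 0 ×ˢ 𝓝[>] 0) ⊓ comap (fun p => p.1 / p.2) (𝓝 0)

/-- Along `L`, the step sizes `(t, r)` are positive with `t ↓ 0`, `r ↓ 0` and `t / r → τ`. The ratio `τ` is `1` for `T²` and `0` for `T''`. -/
structure IsStepFilter (L : Filter (ℝ × ℝ)) (τ : ℝ) : Prop where
  le_nhdsGT : L ≤ 𝓝[>] 0 ×ˢ 𝓝[>] 0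
  ratio : Tendsto (fun p : ℝ × ℝ => p.1 / p.2) L (𝓝 τ)
  countable : L.IsCountablyGenerated

namespace IsStepFilter

variable {L : Filter (ℝ × ℝ)} {τ : ℝ}

lemma tendsto_left (h : IsStepFilter L τ) : Tendsto Prod.fst L (𝓝[>] 0) :=
  tendsto_fst.mono_left h.le_nhdsGT

lemma tendsto_right (h : IsStepFilter L τ) : Tendsto Prod.snd L (𝓝[>] 0) :=
  tendsto_snd.mono_left h.le_nhdsGT

end IsStepFilter

lemma isStepFilter_diagonal : IsStepFilter diagonalSteps 1 where
  le_nhdsGT := tendsto_id.prodMk tendsto_id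
  ratio := by
    refine tendsto_map'_iff.2 ((tendsto_congr' ?_).2 tendsto_const_nhds)
    filter_upwards [self_mem_nhdsWithin] with t (ht : 0 < t)
    simp [ht.ne']
  countable := by unfold diagonalSteps; infer_instance

lemma isStepFilter_asymp : IsStepFilter asympSteps 0 where
  le_nhdsGT := inf_le_left
  ratio := tendsto_comap.mono_left inf_le_right
  countable := by unfold asympSteps; infer_instance

lemma secondTangentSet_eq (S : Set E) (x d : E) :
    secondTangentSet S x d = parabolicTangentSet diagonalSteps S x d := by
  ext w
  have hc := isStepFilter_diagonal.countable
  constructor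
  · rintro ⟨t, u, ht, ht0, hu, hS⟩
    have hd : Tendsto (fun k => (t k, t k)) atTop diagonalSteps :=
      tendsto_map.comp (tendsto_nhdsWithin_iff.2 ⟨ht0, Eventually.of_forall ht⟩)
    refine (hd.prodMk hu).frequently (Frequently.of_forall fun k => ?_)
    simpa [pow_two, mul_assoc] using hS k
  · intro h
    obtain ⟨q, hq, hS⟩ := exists_seq_forall_of_frequently h
    have h1 := tendsto_fst.comp hq
    have h2 := tendsto_snd.comp hq
    have hdiag : ∀ᶠ p : ℝ × ℝ in diagonalSteps, 0 < p.1 ∧ p.2 = p.1 :=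
      eventually_map.2 (by filter_upwards [self_mem_nhdsWithin] with t ht using ⟨ht, rfl⟩)
    obtain ⟨N, hN⟩ := eventually_atTop.1 (h1.eventually hdiag)
    have hsh := tendsto_add_atTop_nat N
    refine ⟨fun k => (q (k + N)).1.1, fun k => (q (k + N)).2, fun k => (hN _ (by simp)).1,
      ?_, h2.comp hsh, fun k => ?_⟩
    · exact ((isStepFilter_diagonal.tendsto_left.comp h1).mono_right
        nhdsWithin_le_nhds).comp hsh
    · have := hS (k + N)
      have e := (hN (k + N) (by simp)).2
      simp only [Function.comp] at e
      rw [e] at this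
      simpa [pow_two, mul_assoc] using this

lemma asympSecondTangentCone_eq (S : Set E) (x d : E) :
    asympSecondTangentCone S x d = parabolicTangentSet asympSteps S x d := by
  ext w
  have hc := isStepFilter_asymp.countable
  constructor
  · rintro ⟨t, r, u, ht, hr, ht0, hr0, hratio, hu, hS⟩
    have hd : Tendsto (fun k => (t k, r k)) atTop asympSteps :=
      tendsto_inf.2 ⟨(tendsto_nhdsWithin_iff.2 ⟨ht0, Eventually.of_forall ht⟩).prodMk
        (tendsto_nhdsWithin_iff.2 ⟨hr0, Eventually.of_forall hr⟩), tendsto_comap_iff.2 hratio⟩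
    exact (hd.prodMk hu).frequently (Frequently.of_forall hS)
  · intro h
    obtain ⟨q, hq, hS⟩ := exists_seq_forall_of_frequently h
    have h1 := tendsto_fst.comp hq
    have h2 := tendsto_snd.comp hq
    have ht := tendsto_nhdsWithin_iff.1 (isStepFilter_asymp.tendsto_left.comp h1)
    have hr := tendsto_nhdsWithin_iff.1 (isStepFilter_asymp.tendsto_right.comp h1)
    obtain ⟨N, hN⟩ := eventually_atTop.1 (ht.2.and hr.2)
    have hsh := tendsto_add_atTop_nat N
    exact ⟨fun k => (q (k + N)).1.1, fun k => (q (k + N)).1.2, fun k => (q (k + N)).2,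
      fun k => (hN _ (by simp)).1, fun k => (hN _ (by simp)).2, ht.1.comp hsh, hr.1.comp hsh,
      (isStepFilter_asymp.ratio.comp h1).comp hsh, h2.comp hsh, fun k => hS _⟩

lemma isClosed_setOf_frequently_prod_nhds {X Y : Type*} [TopologicalSpace Y] (L : Filter X)
    (P : X × Y → Prop) : IsClosed {w | ∃ᶠ q in L ×ˢ 𝓝 w, P q} := by
  rw [← isOpen_compl_iff, isOpen_iff_mem_nhds]
  intro w hw
  simp only [Set.mem_compl_iff, Set.mem_ofPred_eq, not_frequently] at hw
  obtain ⟨p, hp, r, hr, h⟩ := eventually_prod_iff.1 hw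
  filter_upwards [eventually_eventually_nhds.2 hr] with w' hw'
  simp only [Set.mem_compl_iff, Set.mem_ofPred_eq, not_frequently]
  exact eventually_prod_iff.2 ⟨p, hp, r, hw', h⟩

lemma isClosed_parabolicTangentSet (L : Filter (ℝ × ℝ)) (S : Set E) (x d : E) :
    IsClosed (parabolicTangentSet L S x d) :=
  isClosed_setOf_frequently_prod_nhds L _

/-- A tangent direction `d` makes `0` an asymptotic second-order tangent: if `x + t u ∈ S` with
`u → d`, the deviation `u - d` is absorbed by `r = √(t + ‖u - d‖)`. -/
lemma zero_mem_asympSecondTangentCone {S : Set E} {x d : E} (hd : d ∈ tangentCone S x) :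
    (0 : E) ∈ asympSecondTangentCone S x d := by
  obtain ⟨t, u, ht, ht0, hu, hS⟩ := hd
  set r : ℕ → ℝ := fun k => √(t k + ‖u k - d‖) with hr
  have hpos : ∀ k, 0 < t k + ‖u k - d‖ := fun k => by have := ht k; positivity
  have hrpos : ∀ k, 0 < r k := fun k => Real.sqrt_pos.2 (hpos k)
  have hsq : ∀ k, r k * r k = t k + ‖u k - d‖ := fun k => Real.mul_self_sqrt (hpos k).le
  have hud : Tendsto (fun k => ‖u k - d‖) atTop (𝓝 0) := by
    simpa using (hu.sub_const d).norm
  have hr0 : Tendsto r atTop (𝓝 0) := by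
    simpa using (ht0.add hud).sqrt
  refine ⟨t, r, fun k => (2 / r k) • (u k - d), ht, hrpos, ht0, hr0, ?_, ?_, fun k => ?_⟩
  · refine squeeze_zero (fun k => (div_pos (ht k) (hrpos k)).le) (fun k => ?_) hr0
    rw [div_le_iff₀ (hrpos k), hsq]
    linarith [norm_nonneg (u k - d)]
  · refine squeeze_zero_norm (fun k => ?_) (by simpa using hr0.const_mul 2)
    rw [norm_smul, Real.norm_of_nonneg (div_pos two_pos (hrpos k)).le, div_mul_eq_mul_div,
      div_le_iff₀ (hrpos k), mul_assoc, hsq]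
    linarith [ht k]
  · convert hS k using 1
    rw [smul_smul, show 1 / 2 * t k * r k * (2 / r k) = t k by
      field_simp [(hrpos k).ne'], add_assoc, ← smul_add]
    simp

end ParabolicTangent

/-! ### Normals to tangent sets are directional limiting normals -/

section Normals

variable {E : Type*} [NormedAddCommGroup E] [InnerProductSpace ℝ E]

lemma smul_mem_frechetNormalCone {S : Set E} {x v : E} (hv : v ∈ frechetNormalCone S x) {c : ℝ}
    (hc : 0 < c) : c • v ∈ frechetNormalCone S x := by
  refine ⟨hv.1, fun ε hε => ?_⟩
  filter_upwards [hv.2 (ε / c) (div_pos hε hc)] with y hy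
  rw [real_inner_smul_left]
  calc c * inner ℝ v (y - x) ≤ c * (ε / c * ‖y - x‖) := by gcongr
    _ = ε * ‖y - x‖ := by field_simp

/-- A vector from a point to one whose nearest point it is, is a Fréchet normal. -/
lemma sub_mem_frechetNormalCone {S : Set E} {z p : E} (hp : p ∈ S)
    (h : ∀ q ∈ S, ‖z - p‖ ≤ ‖z - q‖) : z - p ∈ frechetNormalCone S p := by
  refine ⟨hp, fun ε hε => ?_⟩
  filter_upwards [self_mem_nhdsWithin, mem_nhdsWithin_of_mem_nhds (Metric.ball_mem_nhds p hε)]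
    with q hq hqp
  have h1 := pow_le_pow_left₀ (norm_nonneg _) (h q hq) 2
  have h2 : ‖z - q‖ ^ 2 = ‖z - p‖ ^ 2 - 2 * inner ℝ (z - p) (q - p) + ‖q - p‖ ^ 2 := by
    rw [← norm_sub_sq_real]; congr 2; abel
  rw [Metric.mem_ball, dist_eq_norm] at hqp
  nlinarith [norm_nonneg (q - p)]

lemma dirLimitingNormalCone_eq (S : Set E) (x d : E) :
    dirLimitingNormalCone S x d =
      {v | ∃ᶠ q in (𝓝[>] (0 : ℝ) ×ˢ 𝓝 d) ×ˢ 𝓝 v,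
        q.2 ∈ frechetNormalCone S (x + q.1.1 • q.1.2)} := by
  ext v
  constructor
  · rintro ⟨t, e, u, ht, ht0, he, hu, hS⟩
    exact (((tendsto_nhdsWithin_iff.2 ⟨ht0, Eventually.of_forall ht⟩).prodMk he).prodMk
      hu).frequently (Frequently.of_forall hS)
  · intro h
    obtain ⟨q, hq, hS⟩ := exists_seq_forall_of_frequently h
    have h1 := tendsto_fst.comp hq
    have ht := tendsto_nhdsWithin_iff.1 (tendsto_fst.comp h1)
    obtain ⟨N, hN⟩ := eventually_atTop.1 ht.2
    have hsh := tendsto_add_atTop_nat N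
    exact ⟨fun k => (q (k + N)).1.1, fun k => (q (k + N)).1.2, fun k => (q (k + N)).2,
      fun k => hN _ (by simp), ht.1.comp hsh, (tendsto_snd.comp h1).comp hsh,
      (tendsto_snd.comp hq).comp hsh, fun k => hS _⟩

lemma isClosed_dirLimitingNormalCone (S : Set E) (x d : E) :
    IsClosed (dirLimitingNormalCone S x d) := by
  rw [dirLimitingNormalCone_eq]
  exact isClosed_setOf_frequently_prod_nhds _ _

lemma smul_mem_dirLimitingNormalCone {S : Set E} {x d v : E}
    (hv : v ∈ dirLimitingNormalCone S x d) {c : ℝ} (hc : 0 < c) :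
    c • v ∈ dirLimitingNormalCone S x d := by
  obtain ⟨t, e, u, ht, ht0, he, hu, hS⟩ := hv
  exact ⟨t, e, fun k => c • u k, ht, ht0, he, hu.const_smul c,
    fun k => smul_mem_frechetNormalCone (hS k) hc⟩

variable [FiniteDimensional ℝ E]

lemma exists_forall_norm_sub_le {S : Set E} (hS : IsClosed S) (hne : S.Nonempty) (z : E) :
    ∃ p ∈ S, ∀ q ∈ S, ‖z - p‖ ≤ ‖z - q‖ := by
  obtain ⟨p, hp, h⟩ := hS.exists_infDist_eq_dist hne z
  refine ⟨p, hp, fun q hq => ?_⟩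
  rw [← dist_eq_norm, ← dist_eq_norm, ← h]
  exact Metric.infDist_le_dist_of_mem hq

/-- If `s` is the only nearest point to `z` in a parabolic tangent set of `K`, then `z - s` is a
directional limiting normal to `K`. The blow-ups `{w | y + t u + ½ t r w ∈ K}` approach `s`, so
the nearest points to `z` in them converge to `s`. -/
lemma sub_mem_dirLimitingNormalCone {L : Filter (ℝ × ℝ)} {τ : ℝ} (hL : IsStepFilter L τ)
    {K : Set E} (hK : IsClosed K) {y u s z : E} (hs : s ∈ parabolicTangentSet L K y u)
    (h : ∀ s' ∈ parabolicTangentSet L K y u, ‖z - s'‖ ≤ ‖z - s‖ → s' = s) :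
    z - s ∈ dirLimitingNormalCone K y u := by
  have := hL.countable
  have hpos : ∀ᶠ q in L ×ˢ 𝓝 s, 0 < q.1.1 ∧ 0 < q.1.2 := by
    have h1 := tendsto_nhdsWithin_iff.1 (hL.tendsto_left.comp (tendsto_fst (f := L) (g := 𝓝 s)))
    have h2 := tendsto_nhdsWithin_iff.1 (hL.tendsto_right.comp (tendsto_fst (f := L) (g := 𝓝 s)))
    exact h1.2.and h2.2
  obtain ⟨q, hq, hqK⟩ := exists_seq_forall_of_frequently (hs.and_eventually hpos)
  set t : ℕ → ℝ := fun k => (q k).1.1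
  set r : ℕ → ℝ := fun k => (q k).1.2
  set a : ℕ → ℝ := fun k => 1 / 2 * t k * r k with ha
  have hqL : Tendsto (fun k => (q k).1) atTop L := tendsto_fst.comp hq
  have ht0 : Tendsto t atTop (𝓝 0) := (hL.tendsto_left.comp hqL).mono_right nhdsWithin_le_nhds
  have hr0 : Tendsto r atTop (𝓝 0) := (hL.tendsto_right.comp hqL).mono_right nhdsWithin_le_nhds
  have hus : Tendsto (fun k => (q k).2) atTop (𝓝 s) := tendsto_snd.comp hq
  have htpos : ∀ k, 0 < t k := fun k => (hqK k).2.1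
  have hrpos : ∀ k, 0 < r k := fun k => (hqK k).2.2
  have hapos : ∀ k, 0 < a k := fun k => by
    have := htpos k; have := hrpos k; positivity
  choose P hPK hP using fun k =>
    exists_forall_norm_sub_le hK ⟨_, (hqK k).1⟩ (y + t k • u + a k • z)
  set p : ℕ → E := fun k => (a k)⁻¹ • (P k - y - t k • u) with hp
  have hPp : ∀ k, P k = y + t k • u + a k • p k := fun k => by
    simp only [hp]
    rw [smul_inv_smul₀ (hapos k).ne']; abel
  have hnorm : ∀ k w, ‖y + t k • u + a k • z - (y + t k • u + a k • w)‖ = a k * ‖z - w‖ :=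
    fun k w => by
      rw [add_sub_add_left_eq_sub, ← smul_sub, norm_smul, Real.norm_of_nonneg (hapos k).le]
  have hpz : ∀ k, ‖z - p k‖ ≤ ‖z - (q k).2‖ := fun k => by
    have h1 := hP k _ (hqK k).1
    rw [hPp k, hnorm] at h1
    change _ ≤ ‖_ - (_ + a k • (q k).2)‖ at h1
    rw [hnorm] at h1
    exact le_of_mul_le_mul_left h1 (hapos k)
  have hlim : Tendsto (fun k => ‖z - (q k).2‖) atTop (𝓝 ‖z - s‖) := (hus.const_sub z).norm
  obtain ⟨B, hB⟩ := hlim.bddAbove_range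
  have hball : ∀ k, p k ∈ Metric.closedBall z B := fun k => by
    rw [Metric.mem_closedBall, dist_comm, dist_eq_norm]
    exact (hpz k).trans (hB ⟨k, rfl⟩)
  obtain ⟨s', -, φ, hφ, hs'⟩ := (isCompact_closedBall z B).tendsto_subseq hball
  have hs'mem : s' ∈ parabolicTangentSet L K y u := by
    refine ((hqL.comp hφ.tendsto_atTop).prodMk hs').frequently (Frequently.of_forall fun k => ?_)
    have := hPK (φ k)
    rw [hPp] at this
    exact this
  have hss : s' = s := h s' hs'mem
    (le_of_tendsto_of_tendsto' (hs'.const_sub z).norm (hlim.comp hφ.tendsto_atTop)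
      fun k => hpz (φ k))
  subst hss
  refine ⟨t ∘ φ, fun k => u + ((1 / 2 : ℝ) * r (φ k)) • p (φ k), fun k => z - p (φ k),
    fun k => htpos _, ht0.comp hφ.tendsto_atTop, ?_, hs'.const_sub z, fun k => ?_⟩
  · have := (((hr0.comp hφ.tendsto_atTop).const_mul (1 / 2 : ℝ)).smul hs').const_add u
    simpa using this
  · have h1 := smul_mem_frechetNormalCone (sub_mem_frechetNormalCone (hPK (φ k)) (hP (φ k)))
      (inv_pos.2 (hapos (φ k)))
    rw [hPp, add_sub_add_left_eq_sub, ← smul_sub, inv_smul_smul₀ (hapos _).ne'] at h1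
    convert h1 using 2
    simp only [Function.comp, ha, smul_add, smul_smul]
    rw [add_assoc]
    ring_nf

/-- A Fréchet normal `v` at `s` is the limit of the vectors `ε⁻¹ (s + ε v - p)`, with `p` a nearest
point to `s + ε v`. Halving the step from `p` to `s + ε v` makes `p` the only nearest point. -/
lemma frechetNormalCone_parabolicTangentSet_subset {L : Filter (ℝ × ℝ)} {τ : ℝ}
    (hL : IsStepFilter L τ) {K : Set E} (hK : IsClosed K) (y u s : E) :
    frechetNormalCone (parabolicTangentSet L K y u) s ⊆ dirLimitingNormalCone K y u := by
  intro v hv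
  set S := parabolicTangentSet L K y u with hSdef
  have hScl : IsClosed S := isClosed_parabolicTangentSet L K y u
  choose p hpS hp using fun ε : ℝ => exists_forall_norm_sub_le hScl ⟨s, hv.1⟩ (s + ε • v)
  have hquad : ∀ ε, ‖p ε - s‖ ^ 2 ≤ 2 * ε * inner ℝ v (p ε - s) := fun ε => by
    have h1 := pow_le_pow_left₀ (norm_nonneg _) (hp ε s hv.1) 2
    have h2 : ‖s + ε • v - p ε‖ ^ 2
        = ‖s + ε • v - s‖ ^ 2 - 2 * inner ℝ (s + ε • v - s) (p ε - s) + ‖p ε - s‖ ^ 2 := by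
      rw [← norm_sub_sq_real]; congr 2; abel
    rw [add_sub_cancel_left, real_inner_smul_left] at h2
    rw [add_sub_cancel_left] at h1
    linarith
  have hbound : ∀ ε > 0, ‖p ε - s‖ ≤ 2 * ε * ‖v‖ := fun ε hε => by
    rcases (norm_nonneg (p ε - s)).eq_or_lt with h0 | h0
    · rw [← h0]; positivity
    · have h2 : 2 * ε * inner ℝ v (p ε - s) ≤ 2 * ε * (‖v‖ * ‖p ε - s‖) := by
        gcongr; exact real_inner_le_norm _ _
      have := hquad ε
      refine le_of_mul_le_mul_right ?_ h0
      nlinarith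
  have hps : Tendsto p (𝓝[>] 0) (𝓝 s) := by
    rw [tendsto_iff_norm_sub_tendsto_zero]
    have h0 : Tendsto (fun ε : ℝ => 2 * ε * ‖v‖) (𝓝[>] 0) (𝓝 0) := by
      have : Continuous fun ε : ℝ => 2 * ε * ‖v‖ := by fun_prop
      simpa using (this.tendsto 0).mono_left nhdsWithin_le_nhds
    refine squeeze_zero' (Eventually.of_forall fun _ => norm_nonneg _) ?_ h0
    filter_upwards [self_mem_nhdsWithin] with ε hε using hbound ε hε
  have hquot : Tendsto (fun ε => ε⁻¹ • (s - p ε)) (𝓝[>] 0) (𝓝 0) := by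
    rw [tendsto_zero_iff_norm_tendsto_zero, Metric.tendsto_nhds]
    intro η hη
    have hev := (tendsto_nhdsWithin_iff.2 ⟨hps, Eventually.of_forall hpS⟩).eventually
      (hv.2 (η / 4) (by positivity))
    filter_upwards [hev, self_mem_nhdsWithin] with ε h1 (hε : 0 < ε)
    have hle : ‖p ε - s‖ ≤ 2 * ε * (η / 4) := by
      rcases (norm_nonneg (p ε - s)).eq_or_lt with h0 | h0
      · rw [← h0]; positivity
      · have h2 : 2 * ε * inner ℝ v (p ε - s) ≤ 2 * ε * (η / 4 * ‖p ε - s‖) := by gcongr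
        have := hquad ε
        refine le_of_mul_le_mul_right ?_ h0
        nlinarith
    rw [dist_zero_right, norm_norm, norm_smul, norm_inv, Real.norm_of_nonneg hε.le, norm_sub_rev,
      inv_mul_lt_iff₀ hε]
    nlinarith
  have hv_lim : Tendsto (fun ε => ε⁻¹ • (s - p ε) + v) (𝓝[>] 0) (𝓝 v) := by
    simpa using hquot.add_const v
  refine (isClosed_dirLimitingNormalCone K y u).mem_of_tendsto hv_lim ?_
  filter_upwards [self_mem_nhdsWithin] with ε (hε : 0 < ε)
  set z := s + ε • v with hz
  have hmem : (1 / 2 : ℝ) • (z - p ε) ∈ dirLimitingNormalCone K y u := by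
    have := sub_mem_dirLimitingNormalCone hL hK (z := p ε + (1 / 2 : ℝ) • (z - p ε)) (hpS ε) ?_
    · simpa using this
    · intro s' hs' hle
      -- Expanding both squares about `p ε`: since `z` is at least as close to `p ε` as to `s'`, the
      -- midpoint of `p ε` and `z` is strictly closer to `p ε` unless `s' = p ε`.
      rw [add_sub_cancel_left] at hle
      have h1 := pow_le_pow_left₀ (norm_nonneg _) hle 2
      have h2 := pow_le_pow_left₀ (norm_nonneg _) (hp ε s' hs') 2
      have e1 : ‖p ε + (1 / 2 : ℝ) • (z - p ε) - s'‖ ^ 2 = ‖(1 / 2 : ℝ) • (z - p ε)‖ ^ 2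
          - 2 * inner ℝ ((1 / 2 : ℝ) • (z - p ε)) (s' - p ε) + ‖s' - p ε‖ ^ 2 := by
        rw [← norm_sub_sq_real]; congr 2; abel
      have e2 : ‖z - s'‖ ^ 2 = ‖z - p ε‖ ^ 2 - 2 * inner ℝ (z - p ε) (s' - p ε)
          + ‖s' - p ε‖ ^ 2 := by
        rw [← norm_sub_sq_real]; congr 2; abel
      rw [real_inner_smul_left] at e1
      have h3 : ‖s' - p ε‖ ^ 2 ≤ 0 := by linarith
      have h4 : ‖s' - p ε‖ = 0 := by
        have := le_antisymm h3 (sq_nonneg _)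
        simpa using this
      exact sub_eq_zero.1 (norm_eq_zero.1 h4)
  have := smul_mem_dirLimitingNormalCone hmem (c := 2 * ε⁻¹) (by positivity)
  convert this using 1
  rw [smul_smul, show 2 * ε⁻¹ * (1 / 2 : ℝ) = ε⁻¹ by ring, hz,
    show s + ε • v - p ε = (s - p ε) + ε • v by abel, smul_add, inv_smul_smul₀ hε.ne']

lemma limitingNormalCone_parabolicTangentSet_subset {L : Filter (ℝ × ℝ)} {τ : ℝ}
    (hL : IsStepFilter L τ) {K : Set E} (hK : IsClosed K) (y u s : E) :
    limitingNormalCone (parabolicTangentSet L K y u) s ⊆ dirLimitingNormalCone K y u := by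
  rintro v ⟨-, _, w, -, -, hw, hN⟩
  exact (isClosed_dirLimitingNormalCone K y u).mem_of_tendsto hw (Eventually.of_forall fun k =>
    frechetNormalCone_parabolicTangentSet_subset hL hK y u _ (hN k))

end Normals

/-! ### Second-order expansion along parabolic curves -/

section Expansion

variable {E : Type*} [NormedAddCommGroup E] [InnerProductSpace ℝ E]
variable {F : Type*} [NormedAddCommGroup F] [InnerProductSpace ℝ F]

open Asymptotics in
/-- Taylor's formula of order two with Peano remainder. -/
lemma taylor_two_isLittleO {h : E → F} (hh : ContDiff ℝ 2 h) (x : E) :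
    (fun u => h (x + u) - h x - fderiv ℝ h x u - (1 / 2 : ℝ) • fderiv ℝ (fderiv ℝ h) x u u)
      =o[𝓝 0] fun u => ‖u‖ ^ 2 := by
  have hd : Differentiable ℝ h := hh.differentiable (by norm_num)
  have hd' : HasFDerivAt (fderiv ℝ h) (fderiv ℝ (fderiv ℝ h) x) x :=
    ((hh.fderiv_right (m := 1) (by norm_num)).differentiable (by norm_num) x).hasFDerivAt
  rw [hasFDerivAt_iff_isLittleO_nhds_zero] at hd'
  refine isLittleO_iff.2 fun ε hε => ?_
  obtain ⟨δ, hδ, hball⟩ := Metric.eventually_nhds_iff_ball.1 (isLittleO_iff.1 hd' hε)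
  filter_upwards [Metric.ball_mem_nhds 0 hδ] with u hu
  -- Mean value inequality along the segment, for the remainder as a function of the parameter.
  set φ : ℝ → F := fun s =>
    h (x + s • u) - s • fderiv ℝ h x u - (s ^ 2 / 2) • fderiv ℝ (fderiv ℝ h) x u u with hφ
  have hderiv : ∀ s : ℝ, HasDerivAt φ
      (fderiv ℝ h (x + s • u) u - fderiv ℝ h x u - s • fderiv ℝ (fderiv ℝ h) x u u) s := by
    intro s
    have h1 : HasDerivAt (fun s : ℝ => x + s • u) u s := by
      simpa using ((hasDerivAt_id s).smul_const u).const_add x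
    have h2 := (hd (x + s • u)).hasFDerivAt.comp_hasDerivAt s h1
    have h3 : HasDerivAt (fun s : ℝ => s • fderiv ℝ h x u) (fderiv ℝ h x u) s := by
      simpa using (hasDerivAt_id s).smul_const (fderiv ℝ h x u)
    have h4 : HasDerivAt (fun s : ℝ => (s ^ 2 / 2) • fderiv ℝ (fderiv ℝ h) x u u)
        (s • fderiv ℝ (fderiv ℝ h) x u u) s := by
      have h5 : HasDerivAt (fun s : ℝ => s ^ 2 / 2) s s := by
        simpa using ((hasDerivAt_id s).pow 2).div_const 2
      exact h5.smul_const _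
    exact (h2.sub h3).sub h4
  have hmain := norm_image_sub_le_of_norm_deriv_le_segment_01' (f := φ) (C := ε * ‖u‖ ^ 2)
    (fun s _ => (hderiv s).hasDerivWithinAt) (fun s hs => by
      have hsu : ‖s • u‖ ≤ ‖u‖ := by
        rw [norm_smul, Real.norm_of_nonneg hs.1]
        exact mul_le_of_le_one_left (norm_nonneg _) hs.2.le
      have h1 := hball (s • u) (by
        rw [mem_ball_zero_iff] at hu ⊢
        exact hsu.trans_lt hu)
      calc ‖fderiv ℝ h (x + s • u) u - fderiv ℝ h x u - s • fderiv ℝ (fderiv ℝ h) x u u‖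
          = ‖(fderiv ℝ h (x + s • u) - fderiv ℝ h x - fderiv ℝ (fderiv ℝ h) x (s • u)) u‖ := by
            simp
        _ ≤ ‖fderiv ℝ h (x + s • u) - fderiv ℝ h x - fderiv ℝ (fderiv ℝ h) x (s • u)‖ * ‖u‖ :=
            ContinuousLinearMap.le_opNorm _ _
        _ ≤ (ε * ‖u‖) * ‖u‖ := by gcongr; exact h1.trans (by gcongr)
        _ = ε * ‖u‖ ^ 2 := by ring)
  have e : φ 1 - φ 0 = h (x + u) - h x - fderiv ℝ h x u
      - (1 / 2 : ℝ) • fderiv ℝ (fderiv ℝ h) x u u := by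
    simp only [hφ]
    simp
    abel
  rw [e] at hmain
  simpa using hmain

namespace IsStepFilter

variable {L : Filter (ℝ × ℝ)} {τ : ℝ}

lemma eventually_pos (hL : IsStepFilter L τ) {X : Type*} [TopologicalSpace X]
    (w : X) :
    ∀ᶠ q in L ×ˢ 𝓝 w, 0 < q.1.1 ∧ 0 < q.1.2 := by
  have h1 := tendsto_nhdsWithin_iff.1 (hL.tendsto_left.comp (tendsto_fst (f := L) (g := 𝓝 w)))
  have h2 := tendsto_nhdsWithin_iff.1 (hL.tendsto_right.comp (tendsto_fst (f := L) (g := 𝓝 w)))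
  exact h1.2.and h2.2

lemma tendsto_left_prod (hL : IsStepFilter L τ) {X : Type*} [TopologicalSpace X]
    (w : X) :
    Tendsto (fun q : (ℝ × ℝ) × X => q.1.1) (L ×ˢ 𝓝 w) (𝓝 0) :=
  (hL.tendsto_left.comp tendsto_fst).mono_right nhdsWithin_le_nhds

lemma tendsto_right_prod (hL : IsStepFilter L τ) {X : Type*} [TopologicalSpace X]
    (w : X) :
    Tendsto (fun q : (ℝ × ℝ) × X => q.1.2) (L ×ˢ 𝓝 w) (𝓝 0) :=
  (hL.tendsto_right.comp tendsto_fst).mono_right nhdsWithin_le_nhds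

lemma tendsto_direction (hL : IsStepFilter L τ) (d w : E) :
    Tendsto (fun q : (ℝ × ℝ) × E => d + ((1 / 2 : ℝ) * q.1.2) • q.2) (L ×ˢ 𝓝 w) (𝓝 d) := by
  simpa using (((hL.tendsto_right_prod w).const_mul (1 / 2 : ℝ)).smul tendsto_snd).const_add d

end IsStepFilter

lemma smul_direction (d w : E) (t r : ℝ) :
    t • d + ((1 / 2 : ℝ) * t * r) • w = t • (d + ((1 / 2 : ℝ) * r) • w) := by
  rw [smul_add, smul_smul]; ring_nf

lemma eventually_mem_dirNhd {L : Filter (ℝ × ℝ)} {τ : ℝ} (hL : IsStepFilter L τ) (d w : E)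
    {ρ δ : ℝ} (hρ : 0 < ρ) (hδ : 0 < δ) :
    ∀ᶠ q in L ×ˢ 𝓝 w, q.1.1 • d + ((1 / 2 : ℝ) * q.1.1 * q.1.2) • q.2 ∈ dirNhd ρ δ d := by
  have he := hL.tendsto_direction d w
  have h0 : ∀ᶠ q : (ℝ × ℝ) × E in L ×ˢ 𝓝 w,
      ‖q.1.1 • (d + ((1 / 2 : ℝ) * q.1.2) • q.2)‖ < δ := by
    have := ((hL.tendsto_left_prod w).smul he).norm
    rw [zero_smul, norm_zero] at this
    exact this.eventually_lt_const hδ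
  have h1 : ∀ᶠ q : (ℝ × ℝ) × E in L ×ˢ 𝓝 w,
      ‖‖d‖ • (d + ((1 / 2 : ℝ) * q.1.2) • q.2) - ‖d + ((1 / 2 : ℝ) * q.1.2) • q.2‖ • d‖
        ≤ ρ * ‖d + ((1 / 2 : ℝ) * q.1.2) • q.2‖ * ‖d‖ := by
    rcases eq_or_ne d 0 with rfl | hd
    · simp
    · have hl := ((he.const_smul ‖d‖).sub (he.norm.smul_const d)).norm
      have hr := (he.norm.const_mul ρ).mul_const ‖d‖
      rw [sub_self, norm_zero] at hl
      have hpos : 0 < ρ * ‖d‖ * ‖d‖ := by have := norm_pos_iff.2 hd; positivity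
      exact (hl.eventually_lt hr hpos).mono fun _ h => h.le
  filter_upwards [h0, h1, hL.eventually_pos w] with q hq0 hq1 hq
  rw [smul_direction]
  refine ⟨hq0.le, ?_⟩
  have e : ‖d‖ • q.1.1 • (d + ((1 / 2 : ℝ) * q.1.2) • q.2)
      - ‖q.1.1 • (d + ((1 / 2 : ℝ) * q.1.2) • q.2)‖ • d
      = q.1.1 • (‖d‖ • (d + ((1 / 2 : ℝ) * q.1.2) • q.2)
        - ‖d + ((1 / 2 : ℝ) * q.1.2) • q.2‖ • d) := by
    rw [norm_smul q.1.1, Real.norm_of_nonneg hq.1.le, smul_sub, smul_comm ‖d‖, mul_smul q.1.1 ‖_‖ d]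
  rw [e, norm_smul, norm_smul, Real.norm_of_nonneg hq.1.le]
  calc _ ≤ q.1.1 * (ρ * ‖d + ((1 / 2 : ℝ) * q.1.2) • q.2‖ * ‖d‖) :=
        mul_le_mul_of_nonneg_left hq1 hq.1.le
    _ = _ := by ring

/-- The rescaled second-order difference quotient of `h` along `x + t d + ½ t r w'`. -/
noncomputable def parabolicQuotient (h : E → F) (x d : E) (q : (ℝ × ℝ) × E) : F :=
  ((1 / 2 : ℝ) * q.1.1 * q.1.2)⁻¹ •
    (h (x + q.1.1 • d + ((1 / 2 : ℝ) * q.1.1 * q.1.2) • q.2) - h x - q.1.1 • fderiv ℝ h x d)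

lemma add_smul_parabolicQuotient (h : E → F) (x d : E) {q : (ℝ × ℝ) × E} (h1 : 0 < q.1.1)
    (h2 : 0 < q.1.2) :
    h x + q.1.1 • fderiv ℝ h x d + ((1 / 2 : ℝ) * q.1.1 * q.1.2) • parabolicQuotient h x d q
      = h (x + q.1.1 • d + ((1 / 2 : ℝ) * q.1.1 * q.1.2) • q.2) := by
  rw [parabolicQuotient, smul_inv_smul₀ (by positivity)]; abel

lemma tendsto_parabolicQuotient {L : Filter (ℝ × ℝ)} {τ : ℝ} (hL : IsStepFilter L τ) {h : E → F}
    (hh : ContDiff ℝ 2 h) (x d w : E) :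
    Tendsto (parabolicQuotient h x d) (L ×ˢ 𝓝 w)
      (𝓝 (fderiv ℝ h x w + τ • secondDeriv h x d)) := by
  set e : (ℝ × ℝ) × E → E := fun q => d + ((1 / 2 : ℝ) * q.1.2) • q.2 with he_def
  have he : Tendsto e (L ×ˢ 𝓝 w) (𝓝 d) := hL.tendsto_direction d w
  have ht := hL.tendsto_left_prod w
  have hτ : Tendsto (fun q : (ℝ × ℝ) × E => q.1.1 / q.1.2) (L ×ˢ 𝓝 w) (𝓝 τ) :=
    hL.ratio.comp tendsto_fst
  set R : E → F := fun u =>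
    h (x + u) - h x - fderiv ℝ h x u - (1 / 2 : ℝ) • fderiv ℝ (fderiv ℝ h) x u u with hR_def
  have hte : Tendsto (fun q : (ℝ × ℝ) × E => q.1.1 • e q) (L ×ˢ 𝓝 w) (𝓝 0) := by
    simpa using ht.smul he
  have hR : Tendsto (fun q : (ℝ × ℝ) × E => (q.1.1 ^ 2)⁻¹ • R (q.1.1 • e q)) (L ×ˢ 𝓝 w) (𝓝 0) := by
    have h1 := (taylor_two_isLittleO hh x).comp_tendsto hte
    refine Asymptotics.IsLittleO.tendsto_inv_smul_nhds_zero (h1.trans_isBigO ?_)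
    have h2 : (fun q => ‖e q‖ ^ 2) =O[L ×ˢ 𝓝 w] fun _ => (1 : ℝ) := (he.norm.pow 2).isBigO_one ℝ
    have h3 := (Asymptotics.isBigO_refl (fun q : (ℝ × ℝ) × E => q.1.1 ^ 2) (L ×ˢ 𝓝 w)).mul h2
    refine h3.congr (fun q => ?_) (fun q => mul_one _)
    simp [norm_smul, mul_pow]
  have hmain : Tendsto (fun q : (ℝ × ℝ) × E => fderiv ℝ h x q.2
      + (q.1.1 / q.1.2) • fderiv ℝ (fderiv ℝ h) x (e q) (e q)
      + (2 * (q.1.1 / q.1.2)) • ((q.1.1 ^ 2)⁻¹ • R (q.1.1 • e q))) (L ×ˢ 𝓝 w)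
      (𝓝 (fderiv ℝ h x w + τ • fderiv ℝ (fderiv ℝ h) x d d + (2 * τ) • (0 : F))) := by
    refine ((((fderiv ℝ h x).continuous.tendsto w).comp tendsto_snd).add (hτ.smul ?_)).add
      ((hτ.const_mul 2).smul hR)
    have h1 : Tendsto (fun q => fderiv ℝ (fderiv ℝ h) x (e q)) (L ×ˢ 𝓝 w)
        (𝓝 (fderiv ℝ (fderiv ℝ h) x d)) :=
      ((fderiv ℝ (fderiv ℝ h) x).continuous.tendsto d).comp he
    exact (isBoundedBilinearMap_apply.continuous.tendsto (_, d)).comp (h1.prodMk_nhds he)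
  rw [smul_zero, add_zero] at hmain
  refine hmain.congr' ?_
  filter_upwards [hL.eventually_pos w] with q hq
  obtain ⟨h1, h2⟩ := hq
  simp only [parabolicQuotient, hR_def]
  rw [add_assoc x, smul_direction]
  change _ = _ • (h (x + q.1.1 • e q) - _ - _)
  generalize hX : h (x + q.1.1 • e q) = X
  have hlin : fderiv ℝ h x (q.1.1 • e q) = q.1.1 • fderiv ℝ h x d
      + ((1 / 2 : ℝ) * q.1.1 * q.1.2) • fderiv ℝ h x q.2 := by
    rw [he_def, ← smul_direction]; simp
  rw [hlin]
  simp only [map_smul, smul_apply]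
  match_scalars <;> field_simp <;> ring

/-- The limit of the second-order difference quotients of `f`, which are nonnegative at feasible
points because `∇f(x) d = 0`. -/
lemma IsDirLocalMin.nonneg_of_mem {L : Filter (ℝ × ℝ)} {τ : ℝ} (hL : IsStepFilter L τ)
    {f : E → ℝ} (hf : ContDiff ℝ 2 f) {C : Set E} {x d w : E} (hmin : IsDirLocalMin f C x d)
    (hfd : fderiv ℝ f x d = 0) (hw : w ∈ parabolicTangentSet L C x d) :
    0 ≤ fderiv ℝ f x w + τ * secondDeriv f x d := by
  obtain ⟨-, ρ, δ, hρ, hδ, hmin⟩ := hmin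
  by_contra! hneg
  have hlim := tendsto_parabolicQuotient hL hf x d w
  obtain ⟨q, hqC, hqneg, hqV, h1, h2⟩ := (hw.and_eventually ((hlim.eventually_lt_const hneg).and
    ((eventually_mem_dirNhd hL d w hρ hδ).and (hL.eventually_pos w)))).exists
  rw [add_assoc] at hqC
  have h3 := hmin _ hqV hqC
  rw [← add_assoc] at h3
  rw [parabolicQuotient, hfd, smul_zero, sub_zero, smul_eq_mul] at hqneg
  have : 0 < ((1 / 2 : ℝ) * q.1.1 * q.1.2)⁻¹ := by positivity
  nlinarith

lemma map_mem_parabolicTangentSet {L : Filter (ℝ × ℝ)} {τ : ℝ} (hL : IsStepFilter L τ)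
    {g : E → F} (hg : ContDiff ℝ 2 g) {K : Set F} {x d w : E}
    (hw : w ∈ parabolicTangentSet L (g ⁻¹' K) x d) :
    fderiv ℝ g x w + τ • secondDeriv g x d
      ∈ parabolicTangentSet L K (g x) (fderiv ℝ g x d) := by
  have hlim : Tendsto (fun q : (ℝ × ℝ) × E => (q.1, parabolicQuotient g x d q)) (L ×ˢ 𝓝 w)
      (L ×ˢ 𝓝 (fderiv ℝ g x w + τ • secondDeriv g x d)) :=
    tendsto_fst.prodMk (tendsto_parabolicQuotient hL hg x d w)
  refine hlim.frequently ((hw.and_eventually (hL.eventually_pos w)).mono ?_)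
  rintro q ⟨hqK, h1, h2⟩
  rw [add_smul_parabolicQuotient g x d h1 h2]
  exact hqK

/-! ### Error bound for the linearized systems -/

variable [FiniteDimensional ℝ E]

lemma DirMSCQ.exists_near {G : Type*} [NormedAddCommGroup G] {g : E → G} (hg : Continuous g)
    {K : Set G} (hK : IsClosed K) {x d : E} (hx : g x ∈ K) (hcq : DirMSCQ g K x d) :
    ∃ ρ δ κ : ℝ, 0 < ρ ∧ 0 < δ ∧ 0 < κ ∧ ∀ h ∈ dirNhd ρ δ d, ∀ z ∈ K,
      ∃ c ∈ g ⁻¹' K, ‖c - (x + h)‖ ≤ κ * ‖g (x + h) - z‖ := by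
  obtain ⟨ρ, δ, κ, hρ, hδ, hκ, H⟩ := hcq
  refine ⟨ρ, δ, κ, hρ, hδ, hκ, fun h hh z hz => ?_⟩
  have hset : {u | (0 : G) ∈ {y | ∃ z ∈ K, y = g u - z}} = g ⁻¹' K := by
    ext u
    constructor
    · rintro ⟨z, hz, h0⟩
      rw [Set.mem_preimage, sub_eq_zero.1 h0.symm]
      exact hz
    · intro hu
      exact ⟨g u, hu, (sub_self _).symm⟩
  have h1 := H h hh
  rw [hset] at h1
  obtain ⟨c, hc, hcd⟩ := (hK.preimage hg).exists_infDist_eq_dist ⟨x, hx⟩ (x + h)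
  refine ⟨c, hc, ?_⟩
  have h2 : Metric.infEDist (0 : G) {y | ∃ z ∈ K, y = g (x + h) - z}
      ≤ ENNReal.ofReal ‖g (x + h) - z‖ := by
    have hmem : g (x + h) - z ∈ {y | ∃ z ∈ K, y = g (x + h) - z} := ⟨z, hz, rfl⟩
    refine (Metric.infEDist_le_edist_of_mem hmem).trans ?_
    rw [edist_dist, dist_zero_left]
  have h3 : Metric.infEDist (x + h) (g ⁻¹' K) ≤ ENNReal.ofReal (κ * ‖g (x + h) - z‖) := by
    rw [ENNReal.ofReal_mul hκ.le]
    exact h1.trans (by gcongr)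
  rw [norm_sub_rev, ← dist_eq_norm, ← hcd, Metric.infDist]
  exact ENNReal.toReal_le_of_le_ofReal (by positivity) h3

/-- Directional metric subregularity of `g(·) ∈ K` passes to a global error bound for the
linearized system `∇g(x) w + τ ∇²g(x)(d, d) ∈ T_K` between the tangent sets. -/
lemma DirMSCQ.exists_tangent_near {L : Filter (ℝ × ℝ)} {τ : ℝ} (hL : IsStepFilter L τ)
    {g : E → F} (hg : ContDiff ℝ 2 g) {K : Set F} (hK : IsClosed K) {x d : E}
    (hx : g x ∈ K) (hcq : DirMSCQ g K x d) :
    ∃ κ : ℝ, 0 < κ ∧ ∀ w, ∀ z ∈ parabolicTangentSet L K (g x) (fderiv ℝ g x d),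
      ∃ w' ∈ parabolicTangentSet L (g ⁻¹' K) x d,
        ‖w' - w‖ ≤ κ * ‖fderiv ℝ g x w + τ • secondDeriv g x d - z‖ := by
  obtain ⟨ρ, δ, κ, hρ, hδ, hκ, H⟩ := hcq.exists_near hg.continuous hK hx
  refine ⟨κ, hκ, fun w z hz => ?_⟩
  have := hL.countable
  have hcurve : Tendsto (fun q : (ℝ × ℝ) × F => (q.1, w)) (L ×ˢ 𝓝 z) (L ×ˢ 𝓝 w) :=
    tendsto_fst.prodMk tendsto_const_nhds
  obtain ⟨q, hq, hqK⟩ := exists_seq_forall_of_frequently (hz.and_eventually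
    ((hcurve.eventually (eventually_mem_dirNhd hL d w hρ hδ)).and (hL.eventually_pos z)))
  set a : ℕ → ℝ := fun k => (1 / 2 : ℝ) * (q k).1.1 * (q k).1.2 with ha
  have hapos : ∀ k, 0 < a k := fun k => by
    have := (hqK k).2.2.1; have := (hqK k).2.2.2; positivity
  choose c hcK hc using fun k => H _ (hqK k).2.1 _ (hqK k).1
  set p : ℕ → E := fun k => (a k)⁻¹ • (c k - x - (q k).1.1 • d) with hp
  set G : ℕ → F := fun k => parabolicQuotient g x d ((q k).1, w) with hG
  have hcp : ∀ k, c k = x + (q k).1.1 • d + a k • p k := fun k => by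
    simp only [hp]
    rw [smul_inv_smul₀ (hapos k).ne']; abel
  have hbound : ∀ k, ‖p k - w‖ ≤ κ * ‖G k - (q k).2‖ := fun k => by
    have h1 := hc k
    have h2 := add_smul_parabolicQuotient g x d (q := ((q k).1, w)) (hqK k).2.2.1 (hqK k).2.2.2
    simp only [← add_assoc] at h1
    rw [← h2, hcp] at h1
    change ‖_ + a k • p k - (_ + a k • w)‖ ≤ κ * ‖_ + a k • G k - (_ + a k • (q k).2)‖ at h1
    rw [add_sub_add_left_eq_sub, add_sub_add_left_eq_sub, ← smul_sub, ← smul_sub, norm_smul,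
      norm_smul, Real.norm_of_nonneg (hapos k).le, mul_left_comm] at h1
    exact le_of_mul_le_mul_left h1 (hapos k)
  have hlim : Tendsto (fun k => κ * ‖G k - (q k).2‖) atTop
      (𝓝 (κ * ‖fderiv ℝ g x w + τ • secondDeriv g x d - z‖)) :=
    ((((tendsto_parabolicQuotient hL hg x d w).comp (hcurve.comp hq)).sub
      (tendsto_snd.comp hq)).norm).const_mul κ
  obtain ⟨B, hB⟩ := hlim.bddAbove_range
  have hball : ∀ k, p k ∈ Metric.closedBall w B := fun k => by
    rw [Metric.mem_closedBall, dist_eq_norm]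
    exact (hbound k).trans (hB ⟨k, rfl⟩)
  obtain ⟨w', -, φ, hφ, hw'⟩ := (isCompact_closedBall w B).tendsto_subseq hball
  refine ⟨w', ?_, le_of_tendsto_of_tendsto' (hw'.sub_const w).norm
    (hlim.comp hφ.tendsto_atTop) fun k => hbound (φ k)⟩
  have hqL : Tendsto (fun k => (q k).1) atTop L := tendsto_fst.comp hq
  refine ((hqL.comp hφ.tendsto_atTop).prodMk hw').frequently (Frequently.of_forall fun k => ?_)
  have := hcK (φ k)
  rw [hcp] at this
  exact this

end Expansion

/-! ### Multipliers by quadratic penalization, and regularized minimizing sequences -/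

section Multipliers

variable {E : Type*} [NormedAddCommGroup E] [InnerProductSpace ℝ E] [FiniteDimensional ℝ E]
variable {F : Type*} [NormedAddCommGroup F] [InnerProductSpace ℝ F] [FiniteDimensional ℝ F]

/-- A minimizer of the penalized problem `⟪v, w - w₀⟫ + M/2 ‖w - w₀‖² + k/2 dist(A w + b, S)²`,
with its stationarity condition. -/
lemma exists_penalty_minimizer (A : E →L[ℝ] F) {b : F} {S : Set F} (hS : IsClosed S) (v : E)
    {w₀ : E} (h₀ : A w₀ + b ∈ S) {M k : ℝ} (hM : 0 < M) (hk : 0 < k) :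
    ∃ w, ∃ s ∈ S, (∀ s' ∈ S, ‖A w + b - s‖ ≤ ‖A w + b - s'‖) ∧
      v + M • (w - w₀) + ContinuousLinearMap.adjoint A (k • (A w + b - s)) = 0 ∧
      inner ℝ v (w - w₀) + M / 2 * ‖w - w₀‖ ^ 2 + k / 2 * ‖A w + b - s‖ ^ 2 ≤ 0 := by
  set ψ : E → ℝ := fun w =>
    inner ℝ v (w - w₀) + M / 2 * ‖w - w₀‖ ^ 2 + k / 2 * Metric.infDist (A w + b) S ^ 2 with hψ
  have hcont : Continuous ψ := by
    have : Continuous fun w => Metric.infDist (A w + b) S :=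
      (Metric.continuous_infDist_pt S).comp (by fun_prop)
    fun_prop
  have hψ0 : ψ w₀ = 0 := by simp [hψ, Metric.infDist_zero_of_mem h₀]
  obtain ⟨w, -, hw⟩ := (isCompact_closedBall w₀ (2 * ‖v‖ / M)).exists_isMinOn
    ⟨w₀, Metric.mem_closedBall_self (by positivity)⟩ hcont.continuousOn
  have hw0 : ψ w ≤ 0 := hψ0 ▸ hw (Metric.mem_closedBall_self (by positivity))
  have hglob : ∀ w', ψ w ≤ ψ w' := by
    intro w'
    by_cases hw' : w' ∈ Metric.closedBall w₀ (2 * ‖v‖ / M)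
    · exact hw hw'
    · rw [Metric.mem_closedBall, dist_eq_norm, not_le, div_lt_iff₀ hM] at hw'
      have h1 := neg_le_of_abs_le (abs_real_inner_le_norm v (w' - w₀))
      have h2 : 0 ≤ k / 2 * Metric.infDist (A w' + b) S ^ 2 := by positivity
      refine hw0.trans ?_
      simp only [hψ]
      nlinarith [norm_nonneg (w' - w₀)]
  obtain ⟨s, hsS, hs⟩ := hS.exists_infDist_eq_dist ⟨_, h₀⟩ (A w + b)
  rw [dist_eq_norm] at hs
  refine ⟨w, s, hsS, fun s' hs' => ?_, ?_, ?_⟩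
  · rw [← hs, ← dist_eq_norm]; exact Metric.infDist_le_dist_of_mem hs'
  · -- With `s` frozen, `w` still minimizes the now smooth objective.
    set Q : E → ℝ := fun w' =>
      inner ℝ v (w' - w₀) + M / 2 * ‖w' - w₀‖ ^ 2 + k / 2 * ‖A w' + b - s‖ ^ 2 with hQ
    have hmin : ∀ w', Q w ≤ Q w' := fun w' => by
      have h1 : Q w = ψ w := by simp only [hQ, hψ, hs]
      have h2 : ψ w' ≤ Q w' := by
        simp only [hQ, hψ]
        have : Metric.infDist (A w' + b) S ≤ ‖A w' + b - s‖ := by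
          rw [← dist_eq_norm]; exact Metric.infDist_le_dist_of_mem hsS
        have h0 : 0 ≤ Metric.infDist (A w' + b) S := Metric.infDist_nonneg
        gcongr
      exact h1.le.trans ((hglob w').trans h2)
    have hd1 : HasFDerivAt (fun w' : E => w' - w₀) (ContinuousLinearMap.id ℝ E) w :=
      (hasFDerivAt_id w).sub_const w₀
    have hd2 : HasFDerivAt (fun w' : E => A w' + b - s) A w :=
      (A.hasFDerivAt.add_const b).sub_const s
    have hd := (((innerSL ℝ v).hasFDerivAt.comp w hd1).add (hd1.norm_sq.const_mul (M / 2))).add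
      (hd2.norm_sq.const_mul (k / 2))
    have hz := IsLocalMin.hasFDerivAt_eq_zero (f := Q) (Eventually.of_forall hmin) hd
    refine ext_inner_right ℝ fun h => ?_
    have hzh := congrArg (fun l : E →L[ℝ] ℝ => l h) hz
    simp at hzh
    rw [inner_add_left, inner_add_left, ContinuousLinearMap.adjoint_inner_left,
      real_inner_smul_left, real_inner_smul_left, inner_zero_left, inner_sub_left]
    simp only [inner_sub_left, inner_add_left]
    linarith
  · simpa only [hψ, hs] using hw0

/-- Multiplier rule with a bound on the multiplier. The hypothesis `h` combines an error bound for
the system `A w + b ∈ S` with the minimality of `w₀`, up to a quadratic term, for the linear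
objective `v` over its solutions. -/
theorem exists_multiplier (A : E →L[ℝ] F) {b : F} {S : Set F} (hS : IsClosed S) {v w₀ : E}
    (h₀ : A w₀ + b ∈ S) {κ μ : ℝ} (hκ : 0 < κ) (hμ : 0 ≤ μ)
    (h : ∀ w, ∀ s ∈ S, ∃ w', ‖w' - w‖ ≤ κ * ‖A w + b - s‖ ∧
      0 ≤ inner ℝ v (w' - w₀) + μ / 2 * ‖w' - w₀‖ ^ 2) :
    ∃ l ∈ limitingNormalCone S (A w₀ + b),
      v + ContinuousLinearMap.adjoint A l = 0 ∧ ‖l‖ ≤ 4 * κ * ‖v‖ := by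
  have hlow : ∀ w, ∀ s ∈ S, -(‖v‖ * κ * ‖A w + b - s‖) - μ * ‖w - w₀‖ ^ 2
      - μ * κ ^ 2 * ‖A w + b - s‖ ^ 2 ≤ inner ℝ v (w - w₀) := by
    intro w s hs
    obtain ⟨w', hw', hv⟩ := h w s hs
    set q := ‖A w + b - s‖
    have h1 : inner ℝ v (w' - w₀) = inner ℝ v (w - w₀) + inner ℝ v (w' - w) := by
      rw [← inner_add_right]; congr 1; abel
    have h2 : inner ℝ v (w' - w) ≤ ‖v‖ * (κ * q) :=
      (real_inner_le_norm _ _).trans (by gcongr)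
    have h3 : ‖w' - w₀‖ ≤ κ * q + ‖w - w₀‖ := by
      have := norm_add_le (w' - w) (w - w₀)
      rw [sub_add_sub_cancel] at this
      linarith
    have h4 : ‖w' - w₀‖ ^ 2 ≤ 2 * (κ * q) ^ 2 + 2 * ‖w - w₀‖ ^ 2 := by
      have := pow_le_pow_left₀ (norm_nonneg _) h3 2
      nlinarith [sq_nonneg (κ * q - ‖w - w₀‖)]
    have h5 : μ / 2 * ‖w' - w₀‖ ^ 2 ≤ μ / 2 * (2 * (κ * q) ^ 2 + 2 * ‖w - w₀‖ ^ 2) := by gcongr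
    linarith
  -- With proximal weight `2 μ + 1` and penalty `c n ≥ 4 μ κ²`, the quadratic losses in `hlow` are
  -- absorbed and `‖w - w₀‖² / 2 + (c n / 4) ‖A w + b - s‖²` is left over.
  set c : ℕ → ℝ := fun n => n + (4 * μ * κ ^ 2 + 1) with hc
  have hcpos : ∀ n, 0 < c n := fun n => by positivity
  have hcinf : Tendsto c atTop atTop :=
    tendsto_atTop_add_const_right _ _ tendsto_natCast_atTop_atTop
  choose w s hsS hs hstat hval using fun n =>
    exists_penalty_minimizer A hS v h₀ (M := 2 * μ + 1) (by positivity) (hcpos n)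
  have hest : ∀ n, 1 / 2 * ‖w n - w₀‖ ^ 2 + c n / 4 * ‖A (w n) + b - s n‖ ^ 2
      ≤ ‖v‖ * κ * ‖A (w n) + b - s n‖ := fun n => by
    have h1 := hlow (w n) (s n) (hsS n)
    have h2 := hval n
    have h3 : 4 * μ * κ ^ 2 ≤ c n := by
      simp only [hc]; linarith [(Nat.cast_nonneg n : (0 : ℝ) ≤ n)]
    have h4 : 4 * μ * κ ^ 2 * ‖A (w n) + b - s n‖ ^ 2 ≤ c n * ‖A (w n) + b - s n‖ ^ 2 := by gcongr
    linarith
  set l : ℕ → F := fun n => c n • (A (w n) + b - s n) with hl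
  have hlnorm : ∀ n, ‖l n‖ = c n * ‖A (w n) + b - s n‖ := fun n => by
    simp only [hl]; rw [norm_smul, Real.norm_of_nonneg (hcpos n).le]
  have hlbd : ∀ n, ‖l n‖ ≤ 4 * κ * ‖v‖ := fun n => by
    rw [hlnorm]
    rcases (norm_nonneg (A (w n) + b - s n)).eq_or_lt with h0 | h0
    · rw [← h0]; simp; positivity
    · refine le_of_mul_le_mul_right ?_ h0
      nlinarith [hest n, sq_nonneg ‖w n - w₀‖]
  have hq : ∀ n, ‖A (w n) + b - s n‖ ≤ 4 * κ * ‖v‖ * (c n)⁻¹ := fun n => by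
    rw [← div_eq_mul_inv, le_div_iff₀ (hcpos n), mul_comm, ← hlnorm]; exact hlbd n
  have hinv : Tendsto (fun n => (c n)⁻¹) atTop (𝓝 0) := tendsto_inv_atTop_zero.comp hcinf
  have hq0 : Tendsto (fun n => A (w n) + b - s n) atTop (𝓝 0) :=
    squeeze_zero_norm hq (by simpa using hinv.const_mul (4 * κ * ‖v‖))
  have hw : Tendsto w atTop (𝓝 w₀) := by
    rw [tendsto_iff_norm_sub_tendsto_zero]
    have hsq : Tendsto (fun n => ‖w n - w₀‖ ^ 2) atTop (𝓝 0) := by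
      refine squeeze_zero (fun n => sq_nonneg _) (fun n => ?_)
        (by simpa using hq0.norm.const_mul (2 * (‖v‖ * κ)))
      have : 0 ≤ c n / 4 * ‖A (w n) + b - s n‖ ^ 2 := by have := hcpos n; positivity
      linarith [hest n]
    simpa using hsq.sqrt
  have hs0 : Tendsto s atTop (𝓝 (A w₀ + b)) := by
    have h1 := (((A.continuous.tendsto w₀).comp hw).add_const b).sub hq0
    simpa using h1
  obtain ⟨l', hl', φ, hφ, hlim⟩ := (isCompact_closedBall (0 : F) (4 * κ * ‖v‖)).tendsto_subseq
    (x := l) (fun n => mem_closedBall_zero_iff.2 (hlbd n))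
  refine ⟨l', ⟨h₀, s ∘ φ, l ∘ φ, fun n => hsS _, hs0.comp hφ.tendsto_atTop, hlim, fun n => ?_⟩,
    ?_, mem_closedBall_zero_iff.1 hl'⟩
  · exact smul_mem_frechetNormalCone (sub_mem_frechetNormalCone (hsS _) (hs _)) (hcpos _)
  · have h1 : Tendsto (fun n => v + (2 * μ + 1) • (w (φ n) - w₀)
        + ContinuousLinearMap.adjoint A (l (φ n))) atTop
        (𝓝 (v + (2 * μ + 1) • (w₀ - w₀) + ContinuousLinearMap.adjoint A l')) :=
      ((((hw.comp hφ.tendsto_atTop).sub_const w₀).const_smul _).const_add v).add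
        (((ContinuousLinearMap.adjoint A).continuous.tendsto l').comp hlim)
    have h2 := tendsto_nhds_unique (h1.congr fun n => hstat (φ n)) tendsto_const_nhds
    simpa using h2

/-- A minimizer of `⟪v, w⟫ + ε/2 ‖w‖²` over `T` is a nearest point to `-ε⁻¹ v`; minimality is
expanded about the minimizer. -/
lemma exists_regularized_minimizer {T : Set E} (hT : IsClosed T) (hne : T.Nonempty) (v : E) {ε : ℝ}
    (hε : 0 < ε) :
    ∃ w ∈ T, ∀ w' ∈ T, 0 ≤ inner ℝ (v + ε • w) (w' - w) + ε / 2 * ‖w' - w‖ ^ 2 := by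
  obtain ⟨w, hw, h⟩ := exists_forall_norm_sub_le hT hne (-(ε⁻¹ • v))
  refine ⟨w, hw, fun w' hw' => ?_⟩
  have h1 := pow_le_pow_left₀ (norm_nonneg _) (h w' hw') 2
  have e1 : -(ε⁻¹ • v) - w = -(ε⁻¹ • (v + ε • w)) := by
    rw [smul_add, inv_smul_smul₀ hε.ne']; abel
  have e2 : ‖-(ε⁻¹ • v) - w'‖ ^ 2 = ‖-(ε⁻¹ • v) - w‖ ^ 2
      - 2 * inner ℝ (-(ε⁻¹ • v) - w) (w' - w) + ‖w' - w‖ ^ 2 := by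
    rw [← norm_sub_sq_real]; congr 2; abel
  rw [e2, e1, inner_neg_left, real_inner_smul_left] at h1
  have h2 : 0 ≤ ε / 2 * (2 * (ε⁻¹ * inner ℝ (v + ε • w) (w' - w)) + ‖w' - w‖ ^ 2) :=
    mul_nonneg (by positivity) (by linarith)
  calc 0 ≤ _ := h2
    _ = _ := by field_simp

/-- Tikhonov regularization: minimizers `w k` of `⟪v, w⟫ + (ε k)/2 ‖w‖²` over `T` form a minimizing
sequence for `⟪v, ·⟫`, and `ε k ‖w k‖²` vanishes in the limit although `w k` may be unbounded. -/
lemma tendsto_of_regularized_minimizers {H : Type*} [NormedAddCommGroup H]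
    [InnerProductSpace ℝ H] {T : Set H} {v : H} {a : ℝ}
    (ha : IsGLB ((fun w => inner ℝ v w) '' T) a) {ε : ℕ → ℝ} (hε : ∀ k, 0 < ε k)
    (hε0 : Tendsto ε atTop (𝓝 0)) {w : ℕ → H} (hwT : ∀ k, w k ∈ T)
    (hw : ∀ k, ∀ w' ∈ T,
      0 ≤ inner ℝ (v + ε k • w k) (w' - w k) + ε k / 2 * ‖w' - w k‖ ^ 2) :
    Tendsto (fun k => inner ℝ v (w k)) atTop (𝓝 a) ∧
      Tendsto (fun k => ε k * ‖w k‖ ^ 2) atTop (𝓝 0) := by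
  have hlow : ∀ k, a ≤ inner ℝ v (w k) := fun k => ha.1 ⟨_, hwT k, rfl⟩
  have hmin : ∀ k, ∀ w' ∈ T,
      inner ℝ v (w k) + ε k / 2 * ‖w k‖ ^ 2 ≤ inner ℝ v w' + ε k / 2 * ‖w'‖ ^ 2 := by
    intro k w' hw'
    have h1 := hw k w' hw'
    have h2 := norm_sub_sq_real w' (w k)
    rw [inner_add_left, inner_sub_right, inner_sub_right, real_inner_smul_left,
      real_inner_smul_left, h2, real_inner_self_eq_norm_sq, real_inner_comm w' (w k)] at h1
    linarith
  have hsum : Tendsto (fun k => inner ℝ v (w k) + ε k / 2 * ‖w k‖ ^ 2) atTop (𝓝 a) := by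
    refine tendsto_order.2 ⟨fun b hb => Eventually.of_forall fun k => ?_, fun b hb => ?_⟩
    · have := hlow k
      have : 0 ≤ ε k / 2 * ‖w k‖ ^ 2 := by have := hε k; positivity
      linarith
    · obtain ⟨_, ⟨w', hw', rfl⟩, -, hlt⟩ := ha.exists_between hb
      have h1 : Tendsto (fun k => inner ℝ v w' + ε k / 2 * ‖w'‖ ^ 2) atTop (𝓝 (inner ℝ v w')) := by
        simpa using ((hε0.div_const 2).mul_const (‖w'‖ ^ 2)).const_add (inner ℝ v w')
      filter_upwards [h1.eventually_lt_const hlt] with k hk using (hmin k w' hw').trans_lt hk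
  have hv : Tendsto (fun k => inner ℝ v (w k)) atTop (𝓝 a) :=
    tendsto_of_tendsto_of_tendsto_of_le_of_le tendsto_const_nhds hsum hlow fun k => by
      have : 0 ≤ ε k / 2 * ‖w k‖ ^ 2 := by have := hε k; positivity
      simp only; linarith
  refine ⟨hv, ?_⟩
  have := (hsum.sub hv).const_mul 2
  rw [sub_self, mul_zero] at this
  refine this.congr fun k => ?_
  ring

end Multipliers

/-! ### The Lagrangian and the optimal value -/

section Lagrangian

variable {E : Type*} [NormedAddCommGroup E] [InnerProductSpace ℝ E]
variable {F : Type*} [NormedAddCommGroup F] [InnerProductSpace ℝ F]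

lemma fderiv_lagrangian {f : E → ℝ} {g : E → F} (hf : ContDiff ℝ 2 f) (hg : ContDiff ℝ 2 g) (v : F)
    (x : E) :
    fderiv ℝ (fun u => lagrangian f g u v) x = fderiv ℝ f x + (innerSL ℝ v).comp (fderiv ℝ g x) :=
  ((hf.differentiable (by norm_num) x).hasFDerivAt.add
    ((innerSL ℝ v).hasFDerivAt.comp x (hg.differentiable (by norm_num) x).hasFDerivAt)).fderiv

lemma secondDeriv_lagrangian {f : E → ℝ} {g : E → F} (hf : ContDiff ℝ 2 f) (hg : ContDiff ℝ 2 g)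
    (v : F) (x d : E) :
    secondDeriv (fun u => lagrangian f g u v) x d
      = secondDeriv f x d + inner ℝ v (secondDeriv g x d) := by
  have hf' := (((hf.fderiv_right (m := 1) (by norm_num)).differentiable (by norm_num)) x).hasFDerivAt
  have hg' := (((hg.fderiv_right (m := 1) (by norm_num)).differentiable (by norm_num)) x).hasFDerivAt
  have h := hf'.add
    ((ContinuousLinearMap.compL ℝ E F ℝ (innerSL ℝ v)).hasFDerivAt.comp x hg')
  have e : fderiv ℝ (fun u => lagrangian f g u v) =
      fderiv ℝ f + ContinuousLinearMap.compL ℝ E F ℝ (innerSL ℝ v) ∘ fderiv ℝ g :=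
    funext fun y => fderiv_lagrangian hf hg v y
  rw [secondDeriv, e, h.fderiv]
  simp [secondDeriv]

lemma fderiv_apply_eq_of_fderiv_lagrangian_eq_zero {f : E → ℝ} {g : E → F} (hf : ContDiff ℝ 2 f)
    (hg : ContDiff ℝ 2 g) {v : F} {x : E} (h : fderiv ℝ (fun u => lagrangian f g u v) x = 0)
    (w : E) : inner ℝ v (fderiv ℝ g x w) = -fderiv ℝ f x w := by
  rw [fderiv_lagrangian hf hg] at h
  have := congrArg (fun l : E →L[ℝ] ℝ => l w) h
  simp at this
  linarith

lemma inner_gradient [CompleteSpace E] (f : E → ℝ) (x w : E) :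
    inner ℝ (gradient f x) w = fderiv ℝ f x w :=
  InnerProductSpace.toDual_symm_apply

lemma fderiv_lagrangian_eq_zero [CompleteSpace E] [CompleteSpace F] {f : E → ℝ} {g : E → F}
    (hf : ContDiff ℝ 2 f) (hg : ContDiff ℝ 2 g) {v : F} {x : E}
    (h : gradient f x + ContinuousLinearMap.adjoint (fderiv ℝ g x) v = 0) :
    fderiv ℝ (fun u => lagrangian f g u v) x = 0 := by
  rw [fderiv_lagrangian hf hg]
  ext w
  have h1 := congrArg (fun y => inner ℝ y w) h
  simp only [inner_add_left, inner_gradient, ContinuousLinearMap.adjoint_inner_left,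
    inner_zero_left] at h1
  simpa using h1

lemma alphaVal_eq_coe [CompleteSpace E] {f : E → ℝ} {C : Set E} {x d : E} {a : ℝ}
    (ha : IsGLB ((fun w => inner ℝ (gradient f x) w) '' secondTangentSet C x d) a) :
    alphaVal f C x d = ((a + secondDeriv f x d : ℝ) : EReal) := by
  refine le_antisymm (le_of_not_gt fun hlt => ?_) (le_iInf₂ fun w hw => ?_)
  · obtain ⟨c, hac, hc⟩ := EReal.lt_iff_exists_real_btwn.1 hlt
    have hlow : c - secondDeriv f x d ≤ a := by
      refine ha.2 ?_
      rintro _ ⟨w, hw, rfl⟩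
      have := hc.le.trans (iInf₂_le w hw)
      rw [EReal.coe_le_coe_iff] at this
      simp only [inner_gradient]
      linarith
    rw [EReal.coe_lt_coe_iff] at hac
    linarith
  · have := ha.1 ⟨w, hw, rfl⟩
    simp only [inner_gradient] at this
    rw [EReal.coe_le_coe_iff]
    linarith

end Lagrangian

/-! ### Multipliers for the linearized problems -/

section Optimality

variable {E : Type*} [NormedAddCommGroup E] [InnerProductSpace ℝ E] [FiniteDimensional ℝ E]
variable {F : Type*} [NormedAddCommGroup F] [InnerProductSpace ℝ F] [FiniteDimensional ℝ F]

/-- Multiplier rule over the tangent set of `g ⁻¹' K`, with a bound that is uniform in the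
point `w₀`. -/
theorem DirMSCQ.exists_tangent_multiplier {L : Filter (ℝ × ℝ)} {τ : ℝ} (hL : IsStepFilter L τ)
    {g : E → F} (hg : ContDiff ℝ 2 g) {K : Set F} (hK : IsClosed K) {x d : E}
    (hx : g x ∈ K) (hcq : DirMSCQ g K x d) :
    ∃ κ : ℝ, ∀ w₀ ∈ parabolicTangentSet L (g ⁻¹' K) x d, ∀ (v : E) (μ : ℝ), 0 ≤ μ →
      (∀ w ∈ parabolicTangentSet L (g ⁻¹' K) x d,
        0 ≤ inner ℝ v (w - w₀) + μ / 2 * ‖w - w₀‖ ^ 2) →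
      ∃ l ∈ limitingNormalCone (parabolicTangentSet L K (g x) (fderiv ℝ g x d))
          (fderiv ℝ g x w₀ + τ • secondDeriv g x d),
        v + ContinuousLinearMap.adjoint (fderiv ℝ g x) l = 0 ∧ ‖l‖ ≤ κ * ‖v‖ := by
  obtain ⟨κ, hκ, H⟩ := hcq.exists_tangent_near hL hg hK hx
  refine ⟨4 * κ, fun w₀ hw₀ v μ hμ hv => exists_multiplier (fderiv ℝ g x)
    (isClosed_parabolicTangentSet _ _ _ _) (map_mem_parabolicTangentSet hL hg hw₀) hκ hμ
    fun w s hs => ?_⟩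
  obtain ⟨w', hw', hle⟩ := H w s hs
  exact ⟨w', hle, hv w' hw'⟩

end Optimality

end DirOpt

theorem theorem4p4 (n m : ℕ)
    (f : EuclideanSpace ℝ (Fin n) → ℝ)
    (g : EuclideanSpace ℝ (Fin n) → EuclideanSpace ℝ (Fin m))
    (K : Set (EuclideanSpace ℝ (Fin m)))
    (hf : ContDiff ℝ 2 f) (hg : ContDiff ℝ 2 g) (hK : IsClosed K)
    (x d : EuclideanSpace ℝ (Fin n))
    (hd : d ∈ DirOpt.tangentCone (g ⁻¹' K) x)
    (hmin : DirOpt.IsDirLocalMin f (g ⁻¹' K) x d)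
    (hfd : fderiv ℝ f x d = 0)
    (hcq : DirOpt.DirMSCQ g K x d) :
    (∃ v ∈ DirOpt.multipliers f g K x d,
      DirOpt.supportFun (DirOpt.thetaSet g K x d) v ≤ 0 ∧
      v ∈ DirOpt.limitingNormalCone
        (DirOpt.asympSecondTangentCone K (g x) (fderiv ℝ g x d)) 0) ∧
    ((DirOpt.secondTangentSet K (g x) (fderiv ℝ g x d)).Nonempty →
      ∃ v ∈ DirOpt.multipliers f g K x d,
        0 ≤ ((DirOpt.secondDeriv (fun u => DirOpt.lagrangian f g u v) x d : ℝ) : EReal)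
          - DirOpt.supportFun (DirOpt.omegaSet g K x d) v ∧
        ∃ (w : ℕ → EuclideanSpace ℝ (Fin n)) (l : ℕ → EuclideanSpace ℝ (Fin m)),
          (∀ k, w k ∈ DirOpt.secondTangentSet (g ⁻¹' K) x d) ∧
          (∀ k, l k ∈ DirOpt.limitingNormalCone
            (DirOpt.secondTangentSet K (g x) (fderiv ℝ g x d))
            (fderiv ℝ g x (w k) + DirOpt.secondDeriv g x d)) ∧
          Tendsto (fun k => ((fderiv ℝ f x (w k) + DirOpt.secondDeriv f x d : ℝ) : EReal))
            atTop (𝓝 (DirOpt.alphaVal f (g ⁻¹' K) x d)) ∧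
          Tendsto (fun k => inner ℝ
            (ContinuousLinearMap.adjoint (fderiv ℝ g x) (l k) + gradient f x) (w k))
            atTop (𝓝 (0 : ℝ)) ∧
          Tendsto l atTop (𝓝 v)) := by
  open DirOpt in
  have hx : g x ∈ K := hmin.1
  refine ⟨?_, fun hne => ?_⟩
  · have hL := isStepFilter_asymp
    have h0 := zero_mem_asympSecondTangentCone hd
    have hopt : ∀ w ∈ asympSecondTangentCone (g ⁻¹' K) x d, 0 ≤ fderiv ℝ f x w := by
      intro w hw
      rw [asympSecondTangentCone_eq] at hw
      simpa using hmin.nonneg_of_mem hL hf hfd hw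
    obtain ⟨κ, H⟩ := hcq.exists_tangent_multiplier hL hg hK hx
    simp only [← asympSecondTangentCone_eq] at H
    obtain ⟨v, hv, hstat, -⟩ := H 0 h0 (gradient f x) 0 le_rfl (fun w hw => by
      simpa [inner_gradient] using hopt w hw)
    have hstat' := fderiv_lagrangian_eq_zero hf hg hstat
    rw [map_zero, zero_smul, add_zero] at hv
    refine ⟨v, ⟨?_, hstat'⟩, ?_, hv⟩
    · rw [asympSecondTangentCone_eq] at hv
      exact limitingNormalCone_parabolicTangentSet_subset hL hK _ _ _ hv
    · refine iSup₂_le ?_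
      rintro _ ⟨w, hw, rfl⟩
      rw [← EReal.coe_zero, EReal.coe_le_coe_iff,
        fderiv_apply_eq_of_fderiv_lagrangian_eq_zero hf hg hstat']
      linarith [hopt w hw]
  · have hL := isStepFilter_diagonal
    set T := secondTangentSet (g ⁻¹' K) x d with hT
    have hTcl : IsClosed T := by
      rw [hT, secondTangentSet_eq]; exact isClosed_parabolicTangentSet _ _ _ _
    have hTne : T.Nonempty := by
      obtain ⟨z, hz⟩ := hne
      obtain ⟨κ, -, H⟩ := hcq.exists_tangent_near hL hg hK hx
      rw [secondTangentSet_eq] at hz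
      obtain ⟨w, hw, -⟩ := H 0 z hz
      exact ⟨w, by rwa [hT, secondTangentSet_eq]⟩
    have hopt : ∀ w ∈ T, 0 ≤ fderiv ℝ f x w + secondDeriv f x d := by
      intro w hw
      rw [hT, secondTangentSet_eq] at hw
      simpa using hmin.nonneg_of_mem hL hf hfd hw
    obtain ⟨κ, H⟩ := hcq.exists_tangent_multiplier hL hg hK hx
    simp only [← secondTangentSet_eq, one_smul] at H
    have hglb := isGLB_csInf (hTne.image fun w => inner ℝ (gradient f x) w)
      ⟨-secondDeriv f x d, by
        rintro _ ⟨w, hw, rfl⟩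
        have := hopt w hw
        simp only [inner_gradient]
        linarith⟩
    set a := sInf ((fun w => inner ℝ (gradient f x) w) '' T)
    set ε : ℕ → ℝ := fun k => 1 / ((k : ℝ) + 1) with hε_def
    have hε : ∀ k, 0 < ε k := fun k => Nat.one_div_pos_of_nat
    have hε0 : Tendsto ε atTop (𝓝 0) := tendsto_one_div_add_atTop_nhds_zero_nat
    choose w hwT hw using fun k =>
      exists_regularized_minimizer hTcl hTne (gradient f x) (hε k)
    obtain ⟨hval, hreg⟩ := tendsto_of_regularized_minimizers hglb hε hε0 hwT hw
    choose l hlN hlstat hlbd using fun k => H (w k) (hwT k) _ (ε k) (hε k).le (hw k)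
    have hεw : Tendsto (fun k => ε k • w k) atTop (𝓝 0) := by
      -- `‖ε w‖² = ε (ε ‖w‖²)`.
      rw [tendsto_zero_iff_norm_tendsto_zero]
      have h1 := (hε0.mul hreg).sqrt
      rw [mul_zero, Real.sqrt_zero] at h1
      refine h1.congr fun k => ?_
      rw [norm_smul, Real.norm_of_nonneg (hε k).le,
        show ε k * (ε k * ‖w k‖ ^ 2) = (ε k * ‖w k‖) ^ 2 by ring,
        Real.sqrt_sq (mul_nonneg (hε k).le (norm_nonneg _))]
    obtain ⟨B, hB⟩ := ((hεw.const_add (gradient f x)).norm.const_mul κ).bddAbove_range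
    obtain ⟨v, -, φ, hφ, hlim⟩ := (isCompact_closedBall (0 : EuclideanSpace ℝ (Fin m))
      B).tendsto_subseq (x := l)
      (fun k => mem_closedBall_zero_iff.2 ((hlbd k).trans (hB ⟨k, rfl⟩)))
    have hφt := hφ.tendsto_atTop
    have hadj : ∀ k, ContinuousLinearMap.adjoint (fderiv ℝ g x) (l k) + gradient f x
        = -(ε k • w k) := fun k => by
      rw [eq_neg_iff_add_eq_zero, ← hlstat k]; abel
    have hstat : fderiv ℝ (fun u => lagrangian f g u v) x = 0 := by
      refine fderiv_lagrangian_eq_zero hf hg ?_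
      have h1 := (((ContinuousLinearMap.adjoint (fderiv ℝ g x)).continuous.tendsto v).comp
        hlim).add_const (gradient f x)
      have h2 := (hεw.comp hφt).neg
      rw [neg_zero] at h2
      rw [add_comm]
      exact tendsto_nhds_unique h1 (h2.congr fun k => (hadj (φ k)).symm)
    have hvN : v ∈ dirLimitingNormalCone K (g x) (fderiv ℝ g x d) := by
      refine (isClosed_dirLimitingNormalCone _ _ _).mem_of_tendsto hlim
        (Eventually.of_forall fun k => ?_)
      have := hlN (φ k)
      rw [secondTangentSet_eq] at this
      exact limitingNormalCone_parabolicTangentSet_subset hL hK _ _ _ this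
    refine ⟨v, ⟨hvN, hstat⟩, ?_, w ∘ φ, l ∘ φ, fun k => hwT _, fun k => hlN _, ?_, ?_, hlim⟩
    · rw [EReal.sub_nonneg (Or.inl (EReal.coe_ne_top _)) (Or.inl (EReal.coe_ne_bot _))]
      refine iSup₂_le ?_
      rintro _ ⟨w', hw', rfl⟩
      rw [EReal.coe_le_coe_iff, secondDeriv_lagrangian hf hg, inner_add_right,
        fderiv_apply_eq_of_fderiv_lagrangian_eq_zero hf hg hstat]
      linarith [hopt w' hw']
    · rw [alphaVal_eq_coe hglb]
      refine (continuous_coe_real_ereal.tendsto _).comp ?_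
      simp only [inner_gradient] at hval
      exact (hval.comp hφt).add_const _
    · have h1 := (hreg.comp hφt).neg
      rw [neg_zero] at h1
      refine h1.congr fun k => ?_
      simp only [Function.comp]
      rw [hadj, inner_neg_left, real_inner_smul_left, real_inner_self_eq_norm_sq]
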